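/- Let $p$ be a prime, $\omega=e^{2\pi i/p}$, and $n,k,n'\ge 0$. A graph on a finite vertex set $V$ is a symmetric matrix $G$ over $\mathbb F_p$ indexed by $V$ with zero diagonal (entries are edge labels, $0$ means no edge). Its graph state is $|\psi_G\rangle=p^{-|V|/2}\sum_{x\in\mathbb F_p^V}\omega^{\sum_{\{i,j\}}G_{ij}x_ix_j}|x\rangle\in(\mathbb C^p)^{\otimes V}$, and for $C\subseteq\mathbb F_p^V$ the CWS code $(G,C)$ is the span of the states $Z^{c}|\psi_G\rangle$, $c\in C$, where $Z^c|x\rangle=\omega^{c\cdot x}|x\rangle$. Inner code: a graph $G_{\rm in}$ on $n$ vertices and a linear code $C_{\rm in}\subseteq\mathbb F_p^n$ with basis $\alpha_1,\dots,\alpha_k$. Its encoder is the linear map $E:(\mathbb C^p)^{\otimes k}\to(\mathbb C^p)^{\otimes n}$, $E\varphi=\sum_{r\in\mathbb F_p^k}\langle r|(H^\dagger)^{\otimes k}|\varphi\rangle\,Z^{r_1\alpha_1+\dots+r_k\alpha_k}|\psi_{G_{\rm in}}\rangle$, where $H^\dagger|r\rangle=p^{-1/2}\sum_s\omega^{-rs}|s\rangle$.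 (This is the circuit: $H^\dagger$ on the inputs, controlled-$Z^{\alpha_{aj}}$ between input $a$ and qupit $j$ of the graph state, $H$ on the inputs, measurement of the inputs with outcome $0$.) Outer code: a CWS code $Q_{\rm out}=(G_{\rm out},C_{\rm out})$ of length $n'$ over $\mathbb C^{p^k}=(\mathbb C^p)^{\otimes k}$; here $G_{\rm out}$ is a graph on the vertices $(i,a)$, $1\le i\le n'$, $1\le a\le k$, and $C_{\rm out}\subseteq(\mathbb F_p^{k})^{n'}$ is an arbitrary subset, linear or not. The concatenated quantum code is $Q_c=E^{\otimes n'}(Q_{\rm out})$. The classical concatenated code $C_c=C_{\rm in}\odot C_{\rm out}\subseteq(\mathbb F_p^n)^{n'}$ is the set of all words $\big(\sum_a c_{i,a}\alpha_a\big)_{1\le i\le n'}$ with $c\in C_{\rm out}$. The encoding graph has auxiliary vertices $(i,a)$ carrying $G_{\rm out}$ and output vertices $(i,j)$, $1\le j\le n$, carrying $n'$ disjoint copies of $G_{\rm in}$; auxiliary vertex $(i,a)$ is joined to output vertex $(i,j)$ with label $\alpha_{a,j}$. For a graph $F$, a vertex $u$ and a vector $v$ that vanishes on $u$ and on all neighbours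 of $u$, the generalized local complementation at $(u,v)$ replaces $F$ by $F+v^Tf_u+f_u^Tv$, where $f_u$ is the row $u$ of $F$. Graph concatenation, for a given order of the auxiliary vertices, is: for each auxiliary vertex $u$ let $v_u$ be the vector of its labels to the output vertices (zero elsewhere); delete all edges between auxiliary and output vertices; perform in the given order the generalized local complementations at $(u,v_u)$ for all auxiliary $u$; remove the auxiliary vertices. It can be carried out if at each step $v_u$ vanishes on $u$ and on the current neighbours of $u$. Then: 1. The image of $E$ is the CWS code $(G_{\rm in},C_{\rm in})$. 2. If no two adjacent auxiliary vertices of the encoding graph have a common neighbour among the output vertices (automatic for $k=1$, or if $G_{\rm out}$ has no edges inside a block $\{(i,1),\dots,(i,k)\}$), then graph concatenation can be carried out in every order, with a result $G_c$ independent of the order. 3. Whenever graph concatenation can be carried out in some order, with result $G_c$, the concatenated code is the CWS code $$Q_c=(G_c,C_c),\qquad C_c=C_{\rm in}\odot C_{\rm out},$$ and every other order in which it can be carried out gives the same $G_c$. 4. In the situation of 3, let moreover $C_{\rm out}$ be linear with basis $\beta_1,\dots,\beta_m$. Then $C_c$ is linear, with basis $\gamma_l=\big(\sum_a(\beta_l)_{i,a}\alpha_a\big)_i$,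 $1\le l\le m$. If one adds to the encoding graph input vertices $1,\dots,m$, with vertex $l$ joined to the auxiliary vertices with labels $\beta_l$ and to nothing else, then graph concatenation of this larger graph in the same order can be carried out and gives the graph of the concatenated graph code, that is, $G_c$ together with the input vertices $1,\dots,m$, where $l$ is joined to the output vertices with labels $\gamma_l$ (and there are no edges between input vertices). -/

import Mathlib

open scoped BigOperators

/-! ### Graphs with edges labelled by elements of `ZMod p` -/

/-- A graph on the vertex set `V` whose edges carry non-zero labels in `ZMod p`, given by its
adjacency matrix: a symmetric matrix with zero diagonal (label `0` means `no edge`). -/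
@[ext]
structure LabeledGraph (p : ℕ) (V : Type*) where
  adj : Matrix V V (ZMod p)
  symm : ∀ i j, adj i j = adj j i
  loopless : ∀ i, adj i i = 0

namespace LabeledGraph

variable {p : ℕ} {V W U A O : Type*}

/-- The subgraph on the vertices in the image of `f`; with `f` an enumeration of the vertices that
are kept, this removes all the other vertices. -/
def induce (F : LabeledGraph p W) (f : U → W) : LabeledGraph p U where
  adj := fun i j => F.adj (f i) (f j)
  symm := fun i j => F.symm (f i) (f j)
  loopless := fun i => F.loopless (f i)

/-- Generalized local complementation at `(i, v)` may be performed on `F` if `v` vanishes on `i`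
and on all neighbours of `i`. -/
def GLCAdmissible (F : LabeledGraph p W) (i : W) (v : W → ZMod p) : Prop :=
  v i = 0 ∧ ∀ j, F.adj i j ≠ 0 → v j = 0

/-- Generalized local complementation at `(i, v)`: the adjacency matrix `F` is replaced by
`F + vᵀ fᵢ + fᵢᵀ v`, where `fᵢ` is the `i`-th row of `F`. -/
def glc (F : LabeledGraph p W) (i : W) (v : W → ZMod p) (h : F.GLCAdmissible i v) :
    LabeledGraph p W where
  adj := F.adj + Matrix.vecMulVec v (F.adj i) + Matrix.vecMulVec (F.adj i) v
  symm := by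
    intro a b
    simp only [Matrix.add_apply, Matrix.vecMulVec_apply, F.symm a b]
    ring
  loopless := by
    intro a
    have h' : v a * F.adj i a = 0 := by
      by_cases ha : F.adj i a = 0
      · rw [ha, mul_zero]
      · rw [h.2 a ha, zero_mul]
    simp only [Matrix.add_apply, Matrix.vecMulVec_apply, F.loopless a]
    rw [mul_comm (F.adj i a) (v a), h']
    simp

/-- `GLCSteps aux v l F F'`: starting from `F`, the generalized local complementations at
`(aux u, v u)`, for `u` running through the list `l` in order, can all be performed, and they lead
to `F'`. -/
def GLCSteps (aux : A → W) (v : A → W → ZMod p) :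
    List A → LabeledGraph p W → LabeledGraph p W → Prop
  | [], F, F' => F' = F
  | u :: l, F, F' => ∃ h : F.GLCAdmissible (aux u) (v u),
      GLCSteps aux v l (F.glc (aux u) (v u) h) F'

open Classical in
/-- The vector attached to the auxiliary vertex `aux u`: on an output vertex `w` it is the label of
the edge between `aux u` and `w`, and it is `0` on all other vertices. Its support is the set of
output vertices adjacent to `aux u`. -/
noncomputable def outLabels (F : LabeledGraph p W) (aux : A → W) (out : O → W) (u : A) :
    W → ZMod p :=
  fun w => if w ∈ Set.range out then F.adj (aux u) w else 0

open Classical in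
/-- Delete all edges between auxiliary vertices and output vertices. -/
noncomputable def detach (F : LabeledGraph p W) (aux : A → W) (out : O → W) :
    LabeledGraph p W where
  adj := fun i j =>
    if (i ∈ Set.range aux ∧ j ∈ Set.range out) ∨ (i ∈ Set.range out ∧ j ∈ Set.range aux) then 0
    else F.adj i j
  symm := by
    intro i j
    have h : ((i ∈ Set.range aux ∧ j ∈ Set.range out) ∨ (i ∈ Set.range out ∧ j ∈ Set.range aux))
        ↔ ((j ∈ Set.range aux ∧ i ∈ Set.range out) ∨ (j ∈ Set.range out ∧ i ∈ Set.range aux)) := by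
      tauto
    simp only [h, F.symm i j]
  loopless := by
    intro i
    simp only [F.loopless i, ite_self]

/-- `GraphConcatenation F aux out rest l R`: graph concatenation via generalized local
complementation, applied to the graph `F` with auxiliary vertices `aux`, output vertices `out` and
non-auxiliary vertices `rest`, with the auxiliary vertices processed in the order `l`, can be
carried out and yields the graph `R`. One records for every auxiliary vertex its labels to the
output vertices, deletes all edges between auxiliary and output vertices, performs the generalized
local complementations one after the other, and finally removes the auxiliary vertices. -/
def GraphConcatenation (F : LabeledGraph p W) (aux : A → W) (out : O → W) (rest : U → W)
    (l : List A) (R : LabeledGraph p U) : Prop :=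
  ∃ F' : LabeledGraph p W,
    GLCSteps aux (F.outLabels aux out) l (F.detach aux out) F' ∧ R = F'.induce rest

/-- The graph of a graph code: to the graph `G` one adds an input vertex for each row of the
generator matrix `C`; the edge between input vertex `l` and the vertex `v` of `G` has label
`C l v`, and there are no edges between input vertices. -/
def withInputs {m : ℕ} (G : LabeledGraph p V) (C : Matrix (Fin m) V (ZMod p)) :
    LabeledGraph p (Fin m ⊕ V) where
  adj := Matrix.fromBlocks 0 C C.transpose G.adj
  symm := by
    rintro (i | i) (j | j)
    · rfl
    · rfl
    · rfl
    · exact G.symm i j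
  loopless := by
    rintro (i | i)
    · rfl
    · exact G.loopless i

end LabeledGraph

/-- The encoding graph of the concatenated code, without input vertices. The auxiliary vertices
`inl (i, a)`, with `i < n'` and `a < k`, carry the outer graph. The output vertices `inr (i, j)`,
with `i < n'` and `j < n`, carry `n'` disjoint copies of the inner graph. The auxiliary vertex
`(i, a)` is joined to the vertex `(i, j)` of the `i`-th copy with label `C a j`, where `C` is the
generator matrix of the inner classical code. -/
def encodingGraph {p n k n' : ℕ} (Gin : LabeledGraph p (Fin n))
    (Cin : Matrix (Fin k) (Fin n) (ZMod p)) (Gout : LabeledGraph p (Fin n' × Fin k)) :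
    LabeledGraph p ((Fin n' × Fin k) ⊕ (Fin n' × Fin n)) where
  adj := Matrix.fromBlocks Gout.adj
    (Matrix.of fun u w => if u.1 = w.1 then Cin u.2 w.2 else 0)
    (Matrix.of fun w u => if u.1 = w.1 then Cin u.2 w.2 else 0)
    (Matrix.of fun w w' => if w.1 = w'.1 then Gin.adj w.2 w'.2 else 0)
  symm := by
    rintro (u | u) (w | w)
    · exact Gout.symm u w
    · rfl
    · rfl
    · change (if u.1 = w.1 then Gin.adj u.2 w.2 else 0) = if w.1 = u.1 then Gin.adj w.2 u.2 else 0
      rw [Gin.symm u.2 w.2]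
      exact if_congr eq_comm rfl rfl
  loopless := by
    rintro (u | u)
    · exact Gout.loopless u
    · change (if u.1 = u.1 then Gin.adj u.2 u.2 else 0) = 0
      rw [if_pos rfl, Gin.loopless u.2]

/-- The encoding graph of the concatenated code with input vertices, for a linear outer code with
generator matrix `Cout`: input vertex `l` is joined to the auxiliary vertices by the `l`-th row of
`Cout`, and it is not adjacent to any output vertex. -/
def encodingGraphWithInputs {p n k n' m : ℕ} (Gin : LabeledGraph p (Fin n))
    (Cin : Matrix (Fin k) (Fin n) (ZMod p)) (Gout : LabeledGraph p (Fin n' × Fin k))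
    (Cout : Matrix (Fin m) (Fin n' × Fin k) (ZMod p)) :
    LabeledGraph p (Fin m ⊕ ((Fin n' × Fin k) ⊕ (Fin n' × Fin n))) :=
  (encodingGraph Gin Cin Gout).withInputs (Matrix.of fun l => Sum.elim (Cout l) 0)

/-! ### Classical codes -/

/-- The rows of `C` form a basis of the linear code `D`. -/
def IsGeneratorMatrix {p m : ℕ} {V : Type*} (C : Matrix (Fin m) V (ZMod p))
    (D : Submodule (ZMod p) (V → ZMod p)) : Prop :=
  LinearIndependent (ZMod p) (fun l => C l) ∧
    Submodule.span (ZMod p) (Set.range fun l => C l) = D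

/-- Blockwise inner encoding: each of the `n'` blocks `r = (c (i, 0), …, c (i, k - 1))` is replaced
by the codeword `∑ a, r a • (row a of Cin)` which it indexes in the inner code. -/
def blockEncode {p n k n' : ℕ} (Cin : Matrix (Fin k) (Fin n) (ZMod p))
    (c : Fin n' × Fin k → ZMod p) : Fin n' × Fin n → ZMod p :=
  fun w => ∑ a, c (w.1, a) * Cin a w.2

/-- The classical concatenated code; the outer code has length `n'` over the alphabet
`(ZMod p) ^ k`, and `Cin` is the generator matrix of the inner code. -/
def classicalConcat {p n k n' : ℕ} (Cin : Matrix (Fin k) (Fin n) (ZMod p))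
    (Cout : Set (Fin n' × Fin k → ZMod p)) : Set (Fin n' × Fin n → ZMod p) :=
  blockEncode Cin '' Cout

/-! ### Qupits, graph states and CWS codes -/

/-- State vectors of the system with one qupit for each `v : V`: the function `ψ` stands for
`∑ x, ψ x • |x⟩`. -/
abbrev Ket (p : ℕ) (V : Type*) := (V → ZMod p) → ℂ

section Quantum

variable {p : ℕ} [Fact p.Prime] {V : Type*} [Fintype V]

/-- The Pauli operator `Z ^ b = ⨂ᵥ Z ^ (b v)`, with `Z |r⟩ = ω ^ r |r⟩` and
`ω = exp (2 π i / p)`. -/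
noncomputable def pauliZ (b : V → ZMod p) : Ket p V →ₗ[ℂ] Ket p V where
  toFun := fun ψ x => ZMod.stdAddChar (∑ v, b v * x v) * ψ x
  map_add' := by intro ψ φ; ext x; simp [mul_add]
  map_smul' := by intro a ψ; ext x; simp [mul_left_comm]

/-- The operator `H†` applied to every qupit, with `H† |r⟩ = p ^ (-1/2) ∑ s, ω ^ (-r s) |s⟩`. -/
noncomputable def hadamardAdjoint [DecidableEq V] : Ket p V →ₗ[ℂ] Ket p V where
  toFun := fun ψ x => ((Real.sqrt ((p : ℝ) ^ Fintype.card V) : ℝ) : ℂ)⁻¹ *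
    ∑ s : V → ZMod p, ZMod.stdAddChar (-∑ v, s v * x v) * ψ s
  map_add' := by intro ψ φ; ext x; simp [mul_add, Finset.sum_add_distrib]
  map_smul' := by intro a ψ; ext x; simp [Finset.mul_sum, mul_left_comm]

/-- The graph state: controlled-`Z` to the power `G i j` is applied, once for every unordered pair
`{i, j}` of vertices, to the uniform superposition `⨂ᵥ H† |0⟩`. -/
noncomputable def graphState [DecidableEq V] (G : LabeledGraph p V) : Ket p V :=
  fun x => ((Real.sqrt ((p : ℝ) ^ Fintype.card V) : ℝ) : ℂ)⁻¹ *
    ZMod.stdAddChar (∑ e : Sym2 V, Sym2.lift ⟨fun i j => G.adj i j * (x i * x j), fun i j => by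
      change G.adj i j * (x i * x j) = G.adj j i * (x j * x i)
      rw [G.symm i j, mul_comm (x i)]⟩ e)

/-- The CWS code `(G, C)`: the span of the states `Z ^ c |ψ_G⟩`, `c ∈ C`. -/
noncomputable def cwsCode [DecidableEq V] (G : LabeledGraph p V) (C : Set (V → ZMod p)) :
    Submodule ℂ (Ket p V) :=
  Submodule.span ℂ ((fun c => pauliZ c (graphState G)) '' C)

/-- The encoder of the graph code with graph `G` and generator matrix `C`, from `k` qupits to the
qupits of `G`. On the input `φ`: apply `H†` to each of the input qupits, apply controlled-`Z` to
the power `C a v` between input qupit `a` and qupit `v` of the graph state, which gives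
`∑ r, (H†φ) r • |r⟩ ⊗ Z ^ (r C) |ψ_G⟩`, then apply `H` to the input qupits and measure them with
outcome `0`, that is, take the inner product with `H† |0⟩ ∝ ∑ r, |r⟩` (the resulting map is
normalized to be isometric). -/
noncomputable def graphCodeEncoder [DecidableEq V] {k : ℕ} (G : LabeledGraph p V)
    (C : Matrix (Fin k) V (ZMod p)) : Ket p (Fin k) →ₗ[ℂ] Ket p V :=
  ∑ r : Fin k → ZMod p,
    ((LinearMap.proj r).comp hadamardAdjoint).smulRight
      (pauliZ (fun v => ∑ a, r a * C a v) (graphState G))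

/-- The `n'`-fold tensor power of an operator `E` from `k` to `n` qupits, acting on `n'` blocks:
its matrix entries are the products of those of `E`. -/
noncomputable def blockPower {k n : ℕ} (n' : ℕ) (E : Ket p (Fin k) →ₗ[ℂ] Ket p (Fin n)) :
    Ket p (Fin n' × Fin k) →ₗ[ℂ] Ket p (Fin n' × Fin n) where
  toFun := fun φ y => ∑ x : Fin n' × Fin k → ZMod p,
    (∏ i, E (Pi.single (fun a => x (i, a)) 1) (fun j => y (i, j))) * φ x
  map_add' := by intro ψ φ; ext x; simp [mul_add, Finset.sum_add_distrib]
  map_smul' := by intro a ψ; ext x; simp [Finset.mul_sum, mul_left_comm]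

/-- The concatenated quantum code: each of the `n'` blocks of `k` qupits of the outer code `Qout`
is encoded by the encoder of the inner graph code with graph `Gin` and generator matrix `Cin`. -/
noncomputable def concatenatedCode {n k n' : ℕ} (Gin : LabeledGraph p (Fin n))
    (Cin : Matrix (Fin k) (Fin n) (ZMod p)) (Qout : Submodule ℂ (Ket p (Fin n' × Fin k))) :
    Submodule ℂ (Ket p (Fin n' × Fin n)) :=
  Qout.map (blockPower n' (graphCodeEncoder Gin Cin))

end Quantum

/-!
The exponent of `ω` in the graph state of `G` is the value of a quadratic form `q_G`, which
vanishes on the standard basis and whose polar form is given there by the labels of `G`; so it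
determines `G`, also for `p = 2`. Generalized local complementation at `(u, v)` pulls `q_F` back
along the transvection `z ↦ z + (v ⬝ z) e_u`. The vectors `v_u` of graph concatenation vanish on
all auxiliary vertices, hence these transvections commute, with composition
`z ↦ z + ∑ u, (v_u ⬝ z) e_u`: the order of the steps does not matter, and
`q_Gc y = q_Gout (S y) + ∑ i, q_Gin (y_i)`, where `S` is the matrix of labels between auxiliary and
output vertices and the `y_i` are the blocks of `y`. On the quantum side, Fourier inversion gives
`E φ (y) = √(p ^ k) * φ (C y) * ψ_Gin (y)`, with `C` the generator matrix of the inner code, so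
`E ^ {⊗ n'}` maps `Z ^ c ψ_Gout` to `Z ^ (c S) ψ_Gc`.
-/

section QuadraticForms

open QuadraticMap

theorem quadraticMap_ext_basis {ι R M N : Type*} [CommRing R] [AddCommGroup M] [AddCommGroup N]
    [Module R M] [Module R N] (b : Module.Basis ι R M) {Q Q' : QuadraticMap R M N}
    (h : ∀ i, Q (b i) = Q' (b i)) (hpolar : ∀ i j, polar Q (b i) (b j) = polar Q' (b i) (b j)) :
    Q = Q' := by
  have hsym : polarSym2 Q ∘ Sym2.map b = polarSym2 Q' ∘ Sym2.map b := by
    funext e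
    induction e with
    | _ i j => exact hpolar i j
  ext x
  rw [← Q.sum_polar_sub_repr_sq b, ← Q'.sum_polar_sub_repr_sq b, hsym,
    show Q ∘ b = Q' ∘ b from funext h]

end QuadraticForms

namespace LabeledGraph

open QuadraticMap

section PhaseForm

variable {p : ℕ} {V W : Type*} [Fintype V]

/-- The quadratic form `x ↦ ∑ G i j * x i * x j`, summed over the unordered pairs `{i, j}` of
vertices: the exponent of `ω` in the graph state of `G`. Summing over `Sym2 V` instead of halving
a sum over `V × V` keeps it meaningful for `p = 2`, where it determines `G` but is not determined
by the bilinear form of `G.adj`. -/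
def phaseForm (G : LabeledGraph p V) : QuadraticForm (ZMod p) (V → ZMod p) :=
  ∑ e : Sym2 V, Sym2.lift ⟨fun i j => G.adj i j • QuadraticMap.proj i j, fun i j => by
    ext x
    simp only [smul_apply, proj_apply, G.symm i j, mul_comm (x i)]⟩ e

theorem phaseForm_apply (G : LabeledGraph p V) (x : V → ZMod p) :
    G.phaseForm x = ∑ e : Sym2 V, Sym2.lift ⟨fun i j => G.adj i j * (x i * x j), fun i j => by
      simp only [G.symm i j, mul_comm (x i)]⟩ e := by
  rw [phaseForm, sum_apply]
  refine Finset.sum_congr rfl fun e _ => ?_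
  induction e with
  | _ i j => rfl

theorem phaseForm_single [DecidableEq V] (G : LabeledGraph p V) (i : V) :
    G.phaseForm (Pi.single i 1) = 0 := by
  rw [phaseForm_apply]
  refine Finset.sum_eq_zero fun e _ => ?_
  induction e with
  | _ a b =>
    by_cases hab : a = b
    · simp [hab, G.loopless b]
    · have : a ≠ i ∨ b ≠ i := by grind
      rcases this with h | h <;> simp [h]

theorem polar_phaseForm_single [DecidableEq V] (G : LabeledGraph p V) (i j : V) :
    polar G.phaseForm (Pi.single i 1) (Pi.single j 1) = G.adj i j := by
  rw [polar, phaseForm_single, phaseForm_single, sub_zero, sub_zero, phaseForm_apply,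
    Finset.sum_eq_single s(i, j)]
  · by_cases hij : i = j
    · simp [hij, G.loopless j]
    · simp [hij, Ne.symm hij]
  · intro e _ he
    induction e with
    | _ a b =>
      by_cases hab : a = b
      · simp [hab, G.loopless b]
      · simp only [ne_eq, Sym2.eq_iff] at he
        have : (a ≠ i ∧ a ≠ j) ∨ (b ≠ i ∧ b ≠ j) := by grind
        rcases this with ⟨h, h'⟩ | ⟨h, h'⟩ <;> simp [h, h']
  · simp

theorem eq_phaseForm [DecidableEq V] {G : LabeledGraph p V}
    {Q : QuadraticForm (ZMod p) (V → ZMod p)}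
    (h : ∀ i, Q (Pi.single i 1) = 0)
    (hpolar : ∀ i j, polar Q (Pi.single i 1) (Pi.single j 1) = G.adj i j) : Q = G.phaseForm :=
  quadraticMap_ext_basis (Pi.basisFun (ZMod p) V)
    (by simp only [Pi.basisFun_apply, h, phaseForm_single, implies_true])
    (by simp only [Pi.basisFun_apply, hpolar, polar_phaseForm_single, implies_true])

theorem phaseForm_injective :
    Function.Injective (phaseForm : LabeledGraph p V → QuadraticForm (ZMod p) (V → ZMod p)) := by
  classical
  intro G H h
  ext i j
  rw [← polar_phaseForm_single, h, polar_phaseForm_single]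

theorem phaseForm_induce [Fintype W] [DecidableEq W] (F : LabeledGraph p W) (f : V → W) :
    (F.induce f).phaseForm
      = F.phaseForm.comp (Fintype.linearCombination (ZMod p) fun i => Pi.single (f i) 1) := by
  classical
  symm
  refine eq_phaseForm (fun i => ?_) fun i j => ?_
  · simp only [comp_apply, Fintype.linearCombination_apply_single, one_smul, phaseForm_single]
  · simp only [polar, comp_apply, map_add, Fintype.linearCombination_apply_single, one_smul]
    exact polar_phaseForm_single F (f i) (f j)

theorem GLCAdmissible.mul_adj_eq_zero {F : LabeledGraph p W} {u : W} {v : W → ZMod p}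
    (h : F.GLCAdmissible u v) (w : W) : v w * F.adj u w = 0 := by
  by_cases hw : F.adj u w = 0
  · rw [hw, mul_zero]
  · rw [h.2 w hw, zero_mul]

theorem phaseForm_glc [DecidableEq V] (F : LabeledGraph p V) (u : V) (v : V → ZMod p)
    (h : F.GLCAdmissible u v) :
    (F.glc u v h).phaseForm
      = F.phaseForm.comp
          (LinearMap.transvection (dotProductEquiv (ZMod p) V v) (Pi.single u 1)) := by
  symm
  have hT (i : V) : LinearMap.transvection (dotProductEquiv (ZMod p) V v) (Pi.single u 1)
      (Pi.single i 1) = Pi.single i 1 + v i • Pi.single u 1 := by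
    simp [LinearMap.transvection.apply]
  refine eq_phaseForm (fun i => ?_) fun i j => ?_
  · simp only [comp_apply, hT, QuadraticMap.map_add, QuadraticMap.map_smul, phaseForm_single,
      polar_smul_right, polar_phaseForm_single, F.symm i u, smul_eq_mul, h.mul_adj_eq_zero i]
    ring
  · have hpolar : polar F.phaseForm (Pi.single i 1 + v i • Pi.single u 1)
        (Pi.single j 1 + v j • Pi.single u 1) = (F.glc u v h).adj i j := by
      simp only [polar_add_left, polar_add_right, polar_smul_left, polar_smul_right,
        polar_phaseForm_single, F.loopless u, F.symm i u, smul_eq_mul, glc, Matrix.add_apply,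
        Matrix.vecMulVec_apply]
      ring
    simpa only [polar, comp_apply, map_add, hT] using hpolar

end PhaseForm

section LocalComplementation

variable {p m : ℕ} {W A : Type*} {aux : A → W} {v : A → W → ZMod p} {l : List A}
  {F F' : LabeledGraph p W}

theorem GLCSteps.phaseForm_apply [Fintype W] [DecidableEq W] (hv : ∀ u s, v u (aux s) = 0)
    (h : GLCSteps aux v l F F') (z : W → ZMod p) :
    F'.phaseForm z
      = F.phaseForm (z + (l.map fun u => (v u ⬝ᵥ z) • Pi.single (aux u) 1).sum) := by
  induction l generalizing F with
  | nil => cases h; simp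
  | cons u l ih =>
    obtain ⟨hu, h⟩ := h
    have hdot : v u ⬝ᵥ (l.map fun s => (v s ⬝ᵥ z) • Pi.single (aux s) 1).sum = 0 := by
      rw [← dotProductEquiv_apply_apply, map_list_sum, List.map_map]
      exact List.sum_eq_zero (by simp [hv])
    rw [ih h, phaseForm_glc, comp_apply, LinearMap.transvection.apply, dotProductEquiv_apply_apply,
      dotProduct_add, hdot, add_zero, List.map_cons, List.sum_cons]
    congr 1
    abel

theorem exists_gLCSteps_of_no_common_neighbour (hv : ∀ u s, v u (aux s) = 0)
    (hdetached : ∀ u x, v u x ≠ 0 → F.adj (aux u) x = 0)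
    (hcommon : ∀ u s x, F.adj (aux u) (aux s) ≠ 0 → v u x ≠ 0 → v s x = 0) (l : List A) :
    ∃ F', GLCSteps aux v l F F' := by
  induction l generalizing F with
  | nil => exact ⟨F, rfl⟩
  | cons u l ih =>
    have hu : F.GLCAdmissible (aux u) (v u) :=
      ⟨hv u u, fun x hx => by_contra fun hvx => hx (hdetached u x hvx)⟩
    have hrow (s : A) (x : W) : (F.glc (aux u) (v u) hu).adj (aux s) x
        = F.adj (aux s) x + F.adj (aux u) (aux s) * v u x := by
      simp [glc, Matrix.vecMulVec_apply, hv]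
    obtain ⟨F', h⟩ := ih (F := F.glc (aux u) (v u) hu)
      (fun s x hs => by
        rw [hrow, hdetached s x hs, zero_add]
        exact mul_eq_zero_of_ne_zero_imp_eq_zero fun hus =>
          hcommon s u x (by rwa [F.symm]) hs)
      (fun s t x hst => hcommon s t x (by simpa only [hrow, hv, mul_zero, add_zero] using hst))
    exact ⟨F', hu, h⟩

theorem GLCSteps.withInputs (hv : ∀ u s, v u (aux s) = 0) (h : GLCSteps aux v l F F')
    (C : Matrix (Fin m) W (ZMod p)) :
    GLCSteps (Sum.inr ∘ aux) (fun u => Sum.elim 0 (v u)) l (F.withInputs C)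
      (F'.withInputs (C + (l.map fun u => Matrix.vecMulVec (C.col (aux u)) (v u)).sum)) := by
  induction l generalizing F C with
  | nil => cases h; simp [GLCSteps]
  | cons u l ih =>
    obtain ⟨hu, h⟩ := h
    have hu' : (F.withInputs C).GLCAdmissible (Sum.inr (aux u)) (Sum.elim 0 (v u)) := by
      refine ⟨hu.1, ?_⟩
      rintro (i | w) hw
      · rfl
      · exact hu.2 w hw
    have hglc : (F.withInputs C).glc (Sum.inr (aux u)) (Sum.elim 0 (v u)) hu'
        = (F.glc (aux u) (v u) hu).withInputs (C + Matrix.vecMulVec (C.col (aux u)) (v u)) := by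
      ext (i | w) (j | x) <;>
        simp [glc, LabeledGraph.withInputs, Matrix.vecMulVec_apply, mul_comm]
    have hcol (s : A) : (C + Matrix.vecMulVec (C.col (aux u)) (v u)).col (aux s)
        = C.col (aux s) := by
      ext i
      simp [Matrix.vecMulVec_apply, hv]
    refine ⟨hu', ?_⟩
    rw [List.map_cons, List.sum_cons, ← add_assoc]
    simpa only [hglc, hcol, Function.comp_apply] using
      ih h (C + Matrix.vecMulVec (C.col (aux u)) (v u))

end LocalComplementation

section Concatenation

variable {p m : ℕ} {W A O U : Type*} {aux : A → W} {out : O → W} {rest : U → W} {l l' : List A}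
  {F : LabeledGraph p W} {R R' : LabeledGraph p U}

theorem outLabels_out (F : LabeledGraph p W) (aux : A → W) (out : O → W) (u : A) (w : O) :
    F.outLabels aux out u (out w) = F.adj (aux u) (out w) :=
  if_pos ⟨w, rfl⟩

theorem outLabels_aux (hdisj : ∀ u w, aux u ≠ out w) (u s : A) :
    F.outLabels aux out u (aux s) = 0 :=
  if_neg fun ⟨w, hw⟩ => hdisj s w hw.symm

theorem exists_graphConcatenation_of_no_common_neighbour (hdisj : ∀ u w, aux u ≠ out w)
    (hcommon : ∀ u s w, F.adj (aux u) (aux s) ≠ 0 → F.adj (aux u) (out w) ≠ 0 →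
      F.adj (aux s) (out w) = 0) (rest : U → W) (l : List A) :
    ∃ R, F.GraphConcatenation aux out rest l R := by
  classical
  have hrange {u : A} {x : W} (hx : F.outLabels aux out u x ≠ 0) : ∃ w, out w = x :=
    (ite_ne_right_iff.mp hx).1
  have hdetached (u : A) (x : W) (hx : F.outLabels aux out u x ≠ 0) :
      (F.detach aux out).adj (aux u) x = 0 :=
    if_pos (.inl ⟨⟨u, rfl⟩, hrange hx⟩)
  have hcommon' (u s : A) (x : W) (hus : (F.detach aux out).adj (aux u) (aux s) ≠ 0)
      (hx : F.outLabels aux out u x ≠ 0) : F.outLabels aux out s x = 0 := by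
    obtain ⟨w, rfl⟩ := hrange hx
    rw [outLabels_out] at hx ⊢
    exact hcommon u s w (ite_ne_left_iff.mp hus).2.symm hx
  obtain ⟨F', h⟩ :=
    exists_gLCSteps_of_no_common_neighbour (outLabels_aux hdisj) hdetached hcommon' l
  exact ⟨_, F', h, rfl⟩

theorem GraphConcatenation.eq_of_perm [Finite W] (hdisj : ∀ u w, aux u ≠ out w)
    (hl : l.Perm l') (h : F.GraphConcatenation aux out rest l R)
    (h' : F.GraphConcatenation aux out rest l' R') : R = R' := by
  classical
  have := Fintype.ofFinite W
  obtain ⟨F₁, h₁, rfl⟩ := h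
  obtain ⟨F₂, h₂, rfl⟩ := h'
  suffices F₁ = F₂ by rw [this]
  refine phaseForm_injective (QuadraticMap.ext fun z => ?_)
  rw [h₁.phaseForm_apply (outLabels_aux hdisj), h₂.phaseForm_apply (outLabels_aux hdisj),
    (hl.map _).sum_eq]

theorem exists_forall_graphConcatenation_of_no_common_neighbour [Finite A] [Finite W]
    (hdisj : ∀ u w, aux u ≠ out w)
    (hcommon : ∀ u s w, F.adj (aux u) (aux s) ≠ 0 → F.adj (aux u) (out w) ≠ 0 →
      F.adj (aux s) (out w) = 0) (rest : U → W) :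
    ∃ R, ∀ l : List A, l.Nodup → (∀ u, u ∈ l) → F.GraphConcatenation aux out rest l R := by
  have := Fintype.ofFinite A
  have hexists := exists_graphConcatenation_of_no_common_neighbour hdisj hcommon rest
  obtain ⟨R, hR⟩ := hexists Finset.univ.toList
  refine ⟨R, fun l hl hmem => ?_⟩
  obtain ⟨R', hR'⟩ := hexists l
  have hperm : l.Perm Finset.univ.toList :=
    (List.perm_ext_iff_of_nodup hl (Finset.nodup_toList _)).mpr (by simp [hmem])
  exact hR'.eq_of_perm hdisj hperm hR ▸ hR'

theorem detach_withInputs (F : LabeledGraph p W) (aux : A → W) (out : O → W)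
    (C : Matrix (Fin m) W (ZMod p)) :
    (F.withInputs C).detach (Sum.inr ∘ aux) (Sum.inr ∘ out)
      = (F.detach aux out).withInputs C := by
  classical
  ext (i | x) (j | y)
  · exact ite_self 0
  · exact if_neg (by simp)
  · exact if_neg (by simp)
  · exact if_congr (by simp) rfl rfl

theorem outLabels_withInputs (F : LabeledGraph p W) (aux : A → W) (out : O → W)
    (C : Matrix (Fin m) W (ZMod p)) :
    (F.withInputs C).outLabels (Sum.inr ∘ aux) (Sum.inr ∘ out)
      = fun u => Sum.elim (fun _ => 0) (F.outLabels aux out u) := by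
  classical
  ext u (i | x)
  · exact if_neg (by simp)
  · exact if_congr (by simp) rfl rfl

theorem induce_withInputs (F : LabeledGraph p W) (C : Matrix (Fin m) W (ZMod p)) (rest : U → W) :
    (F.withInputs C).induce (Sum.map id rest)
      = (F.induce rest).withInputs (C.submatrix id rest) := by
  ext (i | x) (j | y) <;> rfl

theorem GraphConcatenation.withInputs (hdisj : ∀ u w, aux u ≠ out w)
    (h : F.GraphConcatenation aux out rest l R) (C : Matrix (Fin m) W (ZMod p)) :
    (F.withInputs C).GraphConcatenation (Sum.inr ∘ aux) (Sum.inr ∘ out) (Sum.map id rest) l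
      (R.withInputs ((C + (l.map fun u =>
        Matrix.vecMulVec (C.col (aux u)) (F.outLabels aux out u)).sum).submatrix id rest)) := by
  obtain ⟨F', h, rfl⟩ := h
  refine ⟨_, ?_, (induce_withInputs F' _ rest).symm⟩
  rw [detach_withInputs, outLabels_withInputs]
  exact h.withInputs (outLabels_aux hdisj) C

end Concatenation

section Bipartition

variable {p m : ℕ} {A O : Type*} [Fintype A] {l : List A}
  {F : LabeledGraph p (A ⊕ O)} {R : LabeledGraph p O}

theorem phaseForm_detach_sumElim [Fintype O] (F : LabeledGraph p (A ⊕ O)) (x : A → ZMod p)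
    (y : O → ZMod p) :
    (F.detach Sum.inl Sum.inr).phaseForm (Sum.elim x y)
      = (F.induce Sum.inl).phaseForm x + (F.induce Sum.inr).phaseForm y := by
  classical
  let Q : QuadraticForm (ZMod p) (A ⊕ O → ZMod p) :=
    (F.induce Sum.inl).phaseForm.comp (LinearMap.funLeft _ _ Sum.inl)
      + (F.induce Sum.inr).phaseForm.comp (LinearMap.funLeft _ _ Sum.inr)
  have hinl (a : A) : Pi.single (M := fun _ : A ⊕ O => ZMod p) (Sum.inl a) 1
      = Sum.elim (Pi.single a 1) (0 : O → ZMod p) := (Sum.elim_single_zero a 1).symm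
  have hinr (o : O) : Pi.single (M := fun _ : A ⊕ O => ZMod p) (Sum.inr o) 1
      = Sum.elim (0 : A → ZMod p) (Pi.single o 1) := (Sum.elim_zero_single o 1).symm
  have hQ (x : A → ZMod p) (y : O → ZMod p) :
      Q (Sum.elim x y) = (F.induce Sum.inl).phaseForm x + (F.induce Sum.inr).phaseForm y := rfl
  have hpolar (x x' : A → ZMod p) (y y' : O → ZMod p) :
      polar Q (Sum.elim x y) (Sum.elim x' y')
        = polar (F.induce Sum.inl).phaseForm x x' + polar (F.induce Sum.inr).phaseForm y y' := by
    simp only [polar, ← Sum.elim_add_add, hQ]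
    ring
  suffices Q = (F.detach Sum.inl Sum.inr).phaseForm by rw [← this, hQ]
  refine eq_phaseForm ?_ ?_
  · rintro (a | o)
    · rw [hinl, hQ, phaseForm_single, map_zero, add_zero]
    · rw [hinr, hQ, phaseForm_single, map_zero, add_zero]
  · rintro (a | o) (b | q) <;>
      simp only [hinl, hinr, hpolar, polar_phaseForm_single, polar_zero_left, polar_zero_right,
        add_zero, zero_add] <;>
      simp [detach, induce]

theorem GraphConcatenation.phaseForm_apply [Fintype O] (hl : l.Nodup) (hmem : ∀ u, u ∈ l)
    (h : F.GraphConcatenation Sum.inl Sum.inr Sum.inr l R) (y : O → ZMod p) :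
    R.phaseForm y = (F.induce Sum.inl).phaseForm (F.adj.toBlocks₁₂.mulVec y)
      + (F.induce Sum.inr).phaseForm y := by
  classical
  obtain ⟨F', h, rfl⟩ := h
  have huniv : l.toFinset = Finset.univ := by simpa [Finset.eq_univ_iff_forall] using hmem
  have hy : Fintype.linearCombination (ZMod p)
      (fun o => Pi.single (M := fun _ : A ⊕ O => ZMod p) (Sum.inr o) 1) y
      = Sum.elim (0 : A → ZMod p) y := by
    ext (a | o) <;> simp [Fintype.linearCombination_apply, Pi.single_apply]
  have hshift : (l.map fun u => (F.outLabels Sum.inl Sum.inr u ⬝ᵥ Sum.elim (0 : A → ZMod p) y) •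
      Pi.single (M := fun _ : A ⊕ O => ZMod p) (Sum.inl u) 1).sum
      = Sum.elim (F.adj.toBlocks₁₂.mulVec y) (0 : O → ZMod p) := by
    rw [← List.sum_toFinset _ hl, huniv]
    ext (a | o) <;>
      simp [Pi.single_apply, dotProduct, outLabels_out, Matrix.mulVec, Matrix.toBlocks₁₂]
  rw [phaseForm_induce, QuadraticMap.comp_apply, hy, h.phaseForm_apply
    (outLabels_aux fun _ _ => Sum.inl_ne_inr), hshift, ← Sum.elim_add_add, zero_add, add_zero,
    phaseForm_detach_sumElim]

theorem GraphConcatenation.withInputs_fromCols_zero (hl : l.Nodup) (hmem : ∀ u, u ∈ l)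
    (h : F.GraphConcatenation Sum.inl Sum.inr Sum.inr l R) (B : Matrix (Fin m) A (ZMod p)) :
    (F.withInputs (Matrix.fromCols B 0)).GraphConcatenation (Sum.inr ∘ Sum.inl)
      (Sum.inr ∘ Sum.inr) (Sum.map id Sum.inr) l (R.withInputs (B * F.adj.toBlocks₁₂)) := by
  classical
  have huniv : l.toFinset = Finset.univ := by simpa [Finset.eq_univ_iff_forall] using hmem
  have hC : (Matrix.fromCols B 0 + (l.map fun u => Matrix.vecMulVec
      ((Matrix.fromCols B (0 : Matrix (Fin m) O (ZMod p))).col (Sum.inl u))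
      (F.outLabels Sum.inl Sum.inr u)).sum).submatrix id Sum.inr = B * F.adj.toBlocks₁₂ := by
    rw [← List.sum_toFinset _ hl, huniv]
    ext i o
    simp [Matrix.sum_apply, Matrix.vecMulVec_apply, outLabels_out, Matrix.mul_apply,
      Matrix.toBlocks₁₂]
  exact hC ▸ h.withInputs (fun _ _ => Sum.inl_ne_inr) _

end Bipartition

section Copies

open scoped Kronecker

variable {p : ℕ} {V : Type*} (ι : Type*) [DecidableEq ι]

/-- The union of disjoint copies of `G`, one for each `i : ι`. -/
def copies (G : LabeledGraph p V) : LabeledGraph p (ι × V) where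
  adj := (1 : Matrix ι ι (ZMod p)) ⊗ₖ G.adj
  symm u w := congrArg₂ (· * ·) (Matrix.isSymm_one.apply w.1 u.1) (G.symm u.2 w.2)
  loopless u := mul_eq_zero_of_right _ (G.loopless u.2)

theorem phaseForm_copies [Fintype ι] [Fintype V] (G : LabeledGraph p V) (y : ι × V → ZMod p) :
    (G.copies ι).phaseForm y = ∑ i, G.phaseForm fun j => y (i, j) := by
  classical
  let Q : QuadraticForm (ZMod p) (ι × V → ZMod p) :=
    ∑ i, G.phaseForm.comp (LinearMap.funLeft _ _ (Prod.mk i))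
  have hQ (y : ι × V → ZMod p) : Q y = ∑ i, G.phaseForm fun j => y (i, j) :=
    sum_apply ..
  have hsingle (i i' : ι) (j : V) : (fun j' => Pi.single (M := fun _ => ZMod p) (i, j) 1 (i', j'))
      = Pi.single (M := fun _ => V → ZMod p) i (Pi.single j 1) i' := by
    ext j'
    by_cases hi : i' = i <;> simp [Pi.single_apply, hi]
  have hpolar (x y : ι × V → ZMod p) : polar Q x y
      = ∑ i, polar G.phaseForm (fun j => x (i, j)) fun j => y (i, j) := by
    simp only [polar, hQ, Finset.sum_sub_distrib]
    rfl
  suffices Q = (G.copies ι).phaseForm by rw [← this, hQ]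
  refine eq_phaseForm ?_ ?_
  · rintro ⟨i, j⟩
    rw [hQ]
    refine Finset.sum_eq_zero fun i' _ => ?_
    rw [hsingle]
    by_cases hi : i' = i
    · rw [hi, Pi.single_eq_same, phaseForm_single]
    · rw [Pi.single_eq_of_ne hi, map_zero]
  · rintro ⟨i, j⟩ ⟨i', j'⟩
    rw [hpolar]
    simp only [hsingle]
    rw [Finset.sum_eq_single i]
    · by_cases hi : i = i'
      · subst hi
        simp [copies, polar_phaseForm_single]
      · simp [copies, hi]
    · intro s _ hs
      rw [Pi.single_eq_of_ne hs, polar_zero_left]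
    · simp

end Copies

end LabeledGraph

section BlockGenerator

open Matrix
open scoped Kronecker

variable {ι κ ν R : Type*} [DecidableEq ι]

/-- The generator matrix of the direct sum of copies of the code generated by `C`, one copy for
each `i : ι`. For the inner code, its rows are the labels between the auxiliary vertices and the
output vertices of the encoding graph. -/
def blockGenerator (ι : Type*) [DecidableEq ι] [MulZeroOneClass R] (C : Matrix κ ν R) :
    Matrix (ι × κ) (ι × ν) R :=
  (1 : Matrix ι ι R) ⊗ₖ C

variable [Fintype ι]

theorem blockGenerator_mulVec_apply [NonAssocSemiring R] [Fintype ν] (C : Matrix κ ν R)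
    (y : ι × ν → R) (i : ι) (a : κ) :
    (blockGenerator ι C *ᵥ y) (i, a) = (C *ᵥ fun j => y (i, j)) a := by
  simp [blockGenerator, mulVec, dotProduct, Fintype.sum_prod_type, one_apply]

theorem vecMul_blockGenerator_apply [NonAssocSemiring R] [Fintype κ] (C : Matrix κ ν R)
    (c : ι × κ → R) (i : ι) (j : ν) :
    (c ᵥ* blockGenerator ι C) (i, j) = ((fun a => c (i, a)) ᵥ* C) j := by
  simp [blockGenerator, vecMul, dotProduct, Fintype.sum_prod_type, one_apply]

theorem vecMul_blockGenerator_injective [Ring R] [Fintype κ] {C : Matrix κ ν R}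
    (hC : LinearIndependent R C.row) : Function.Injective (blockGenerator ι C).vecMul := by
  intro c d h
  ext ⟨i, a⟩
  refine congrFun (vecMul_injective_iff.mpr hC
    (a₁ := fun a => c (i, a)) (a₂ := fun a => d (i, a)) (funext fun j => ?_)) a
  simpa only [vecMul_blockGenerator_apply] using congrFun h (i, j)

end BlockGenerator

section EncodingGraph

open Matrix

variable {p n k n' m : ℕ} {Gin : LabeledGraph p (Fin n)} {Cin : Matrix (Fin k) (Fin n) (ZMod p)}
  {Gout : LabeledGraph p (Fin n' × Fin k)} {Gc : LabeledGraph p (Fin n' × Fin n)}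
  {l : List (Fin n' × Fin k)}

theorem encodingGraph_adj_toBlocks₁₂ (Gin : LabeledGraph p (Fin n))
    (Cin : Matrix (Fin k) (Fin n) (ZMod p)) (Gout : LabeledGraph p (Fin n' × Fin k)) :
    (encodingGraph Gin Cin Gout).adj.toBlocks₁₂ = blockGenerator (Fin n') Cin := by
  ext u w
  simp [encodingGraph, blockGenerator, one_apply]

theorem encodingGraph_induce_inr (Gin : LabeledGraph p (Fin n))
    (Cin : Matrix (Fin k) (Fin n) (ZMod p)) (Gout : LabeledGraph p (Fin n' × Fin k)) :
    (encodingGraph Gin Cin Gout).induce Sum.inr = Gin.copies (Fin n') := by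
  ext u w
  simp [encodingGraph, LabeledGraph.induce, LabeledGraph.copies, one_apply]

theorem blockEncode_eq_vecMul (Cin : Matrix (Fin k) (Fin n) (ZMod p))
    (c : Fin n' × Fin k → ZMod p) : blockEncode Cin c = c ᵥ* blockGenerator (Fin n') Cin :=
  funext fun _ => (vecMul_blockGenerator_apply ..).symm

theorem of_blockEncode_eq_mul (Cin : Matrix (Fin k) (Fin n) (ZMod p))
    (B : Matrix (Fin m) (Fin n' × Fin k) (ZMod p)) :
    Matrix.of (fun i => blockEncode Cin (B i)) = B * blockGenerator (Fin n') Cin := by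
  simp only [blockEncode_eq_vecMul]
  rfl

theorem phaseForm_of_graphConcatenation (hl : l.Nodup) (hmem : ∀ u, u ∈ l)
    (h : (encodingGraph Gin Cin Gout).GraphConcatenation Sum.inl Sum.inr Sum.inr l Gc)
    (y : Fin n' × Fin n → ZMod p) :
    Gc.phaseForm y = Gout.phaseForm (blockGenerator (Fin n') Cin *ᵥ y)
      + (Gin.copies (Fin n')).phaseForm y := by
  rw [h.phaseForm_apply hl hmem, encodingGraph_adj_toBlocks₁₂, encodingGraph_induce_inr]
  rfl

theorem graphConcatenation_encodingGraphWithInputs (hl : l.Nodup) (hmem : ∀ u, u ∈ l)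
    (h : (encodingGraph Gin Cin Gout).GraphConcatenation Sum.inl Sum.inr Sum.inr l Gc)
    (B : Matrix (Fin m) (Fin n' × Fin k) (ZMod p)) :
    (encodingGraphWithInputs Gin Cin Gout B).GraphConcatenation
      (fun u => Sum.inr (Sum.inl u)) (fun w => Sum.inr (Sum.inr w)) (Sum.map id Sum.inr) l
      (Gc.withInputs (Matrix.of fun i => blockEncode Cin (B i))) := by
  rw [of_blockEncode_eq_mul, ← encodingGraph_adj_toBlocks₁₂ Gin Cin Gout]
  exact h.withInputs_fromCols_zero hl hmem B

end EncodingGraph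

section ClassicalCodes

open Matrix

variable {p m : ℕ} {V W : Type*}

theorem IsGeneratorMatrix.range_vecMulLinear {C : Matrix (Fin m) V (ZMod p)}
    {D : Submodule (ZMod p) (V → ZMod p)} (hC : IsGeneratorMatrix C D) :
    LinearMap.range C.vecMulLinear = D :=
  (_root_.range_vecMulLinear C).trans hC.2

theorem IsGeneratorMatrix.mul [Fintype V] {B : Matrix (Fin m) V (ZMod p)}
    {D : Submodule (ZMod p) (V → ZMod p)} (hB : IsGeneratorMatrix B D) {S : Matrix V W (ZMod p)}
    (hS : Function.Injective S.vecMul) : IsGeneratorMatrix (B * S) (D.map S.vecMulLinear) := by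
  refine ⟨hB.1.map' S.vecMulLinear (LinearMap.ker_eq_bot.mpr hS), ?_⟩
  rw [← hB.2, Submodule.map_span, ← Set.range_comp]
  rfl

theorem exists_isGeneratorMatrix_classicalConcat {n k n' : ℕ}
    {Cin : Matrix (Fin k) (Fin n) (ZMod p)} (hCin : LinearIndependent (ZMod p) Cin.row)
    {B : Matrix (Fin m) (Fin n' × Fin k) (ZMod p)}
    {Dout : Submodule (ZMod p) (Fin n' × Fin k → ZMod p)} (hB : IsGeneratorMatrix B Dout) :
    ∃ Dc : Submodule (ZMod p) (Fin n' × Fin n → ZMod p),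
      (Dc : Set (Fin n' × Fin n → ZMod p)) = classicalConcat Cin Dout ∧
      IsGeneratorMatrix (Matrix.of fun i => blockEncode Cin (B i)) Dc := by
  refine ⟨Dout.map (blockGenerator (Fin n') Cin).vecMulLinear, ?_, ?_⟩
  · simp only [Submodule.map_coe, classicalConcat, blockEncode_eq_vecMul]
    rfl
  · rw [of_blockEncode_eq_mul]
    exact hB.mul (vecMul_blockGenerator_injective hCin)

end ClassicalCodes

section Quantum

open Matrix

theorem sqrt_pow_of_nonneg {x : ℝ} (hx : 0 ≤ x) (d : ℕ) :
    Real.sqrt (x ^ d) = Real.sqrt x ^ d := by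
  simpa using Real.sqrt_prod (Finset.range d) fun _ _ => hx

theorem addChar_sum {ι A M : Type*} [AddCommMonoid A] [CommMonoid M] (ψ : AddChar A M)
    (s : Finset ι) (f : ι → A) : ψ (∑ i ∈ s, f i) = ∏ i ∈ s, ψ (f i) :=
  map_prod ψ.toMonoidHom (fun i => Multiplicative.ofAdd (f i)) s

theorem sum_addChar_dotProduct {R R' V : Type*} [CommRing R] [Fintype R] [DecidableEq R]
    [CommRing R'] [IsDomain R'] [Fintype V] [DecidableEq V] {ψ : AddChar R R'}
    (hψ : ψ.IsPrimitive) (t : V → R) :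
    ∑ r : V → R, ψ (r ⬝ᵥ t) = if t = 0 then (Fintype.card R : R') ^ Fintype.card V else 0 := by
  have hfactor (r : V → R) : ψ (r ⬝ᵥ t) = ∏ a, ψ (r a * t a) := by
    rw [dotProduct, addChar_sum]
  simp only [hfactor]
  rw [← Fintype.piFinset_univ,
    ← Finset.prod_univ_sum (fun _ => Finset.univ) fun a r => ψ (r * t a)]
  simp only [AddChar.sum_mulShift _ hψ]
  split_ifs with ht
  · simp [ht]
  · obtain ⟨a, ha⟩ := Function.ne_iff.mp ht
    exact Finset.prod_eq_zero (Finset.mem_univ a) (by simp [show t a ≠ 0 from ha])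

variable {p : ℕ} [Fact p.Prime] {V : Type*} [Fintype V]

theorem ofReal_sqrt_pow_ne_zero (d : ℕ) : ((Real.sqrt ((p : ℝ) ^ d) : ℝ) : ℂ) ≠ 0 := by
  have : (0 : ℝ) < p := by exact_mod_cast (Fact.out : p.Prime).pos
  exact_mod_cast (Real.sqrt_pos.mpr (pow_pos this d)).ne'

theorem pauliZ_apply (b : V → ZMod p) (ψ : Ket p V) (x : V → ZMod p) :
    pauliZ b ψ x = ZMod.stdAddChar (b ⬝ᵥ x) * ψ x :=
  rfl

variable [DecidableEq V]

theorem hadamardAdjoint_apply (φ : Ket p V) (r : V → ZMod p) :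
    hadamardAdjoint φ r = ((Real.sqrt ((p : ℝ) ^ Fintype.card V) : ℝ) : ℂ)⁻¹ *
      ∑ s : V → ZMod p, ZMod.stdAddChar (-(s ⬝ᵥ r)) * φ s :=
  rfl

theorem sum_hadamardAdjoint_mul_stdAddChar (φ : Ket p V) (t : V → ZMod p) :
    ∑ r : V → ZMod p, hadamardAdjoint φ r * ZMod.stdAddChar (r ⬝ᵥ t)
      = ((Real.sqrt ((p : ℝ) ^ Fintype.card V) : ℝ) : ℂ) * φ t := by
  have hkernel (s : V → ZMod p) :
      ∑ r : V → ZMod p, (ZMod.stdAddChar (-(s ⬝ᵥ r)) * ZMod.stdAddChar (r ⬝ᵥ t) : ℂ)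
        = if s = t then (p : ℂ) ^ Fintype.card V else 0 := by
    simp only [← AddChar.map_add_eq_mul, dotProduct_comm s, neg_add_eq_sub, ← dotProduct_sub]
    rw [sum_addChar_dotProduct (ZMod.isPrimitive_stdAddChar p), ZMod.card]
    simp only [sub_eq_zero, eq_comm]
  have hsqrt : ((Real.sqrt ((p : ℝ) ^ Fintype.card V) : ℝ) : ℂ)⁻¹ * (p : ℂ) ^ Fintype.card V
      = ((Real.sqrt ((p : ℝ) ^ Fintype.card V) : ℝ) : ℂ) := by
    rw [inv_mul_eq_div]
    exact_mod_cast Real.div_sqrt (x := (p : ℝ) ^ Fintype.card V)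
  calc ∑ r : V → ZMod p, hadamardAdjoint φ r * ZMod.stdAddChar (r ⬝ᵥ t)
    _ = ((Real.sqrt ((p : ℝ) ^ Fintype.card V) : ℝ) : ℂ)⁻¹ * ∑ s : V → ZMod p,
          (∑ r : V → ZMod p, ZMod.stdAddChar (-(s ⬝ᵥ r)) * ZMod.stdAddChar (r ⬝ᵥ t)) * φ s := by
      simp only [hadamardAdjoint_apply, mul_assoc, Finset.sum_mul, ← Finset.mul_sum]
      rw [Finset.sum_comm]
      simp only [mul_comm (φ _)]
    _ = ((Real.sqrt ((p : ℝ) ^ Fintype.card V) : ℝ) : ℂ)⁻¹ * (p : ℂ) ^ Fintype.card V * φ t := by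
      simp only [hkernel, ite_mul, zero_mul, Finset.sum_ite_eq', Finset.mem_univ, if_true,
        mul_assoc]
    _ = ((Real.sqrt ((p : ℝ) ^ Fintype.card V) : ℝ) : ℂ) * φ t := by rw [hsqrt]

theorem hadamardAdjoint_surjective :
    Function.Surjective (hadamardAdjoint : Ket p V →ₗ[ℂ] Ket p V) := by
  refine LinearMap.injective_iff_surjective.mp fun φ ψ h => funext fun t => ?_
  refine mul_left_cancel₀ (ofReal_sqrt_pow_ne_zero (p := p) (Fintype.card V)) ?_
  rw [← sum_hadamardAdjoint_mul_stdAddChar, h, sum_hadamardAdjoint_mul_stdAddChar]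

theorem graphState_apply (G : LabeledGraph p V) (x : V → ZMod p) :
    graphState G x = ((Real.sqrt ((p : ℝ) ^ Fintype.card V) : ℝ) : ℂ)⁻¹ *
      ZMod.stdAddChar (G.phaseForm x) := by
  rw [LabeledGraph.phaseForm_apply]
  rfl

theorem graphState_copies {ι : Type*} [Fintype ι] [DecidableEq ι] (G : LabeledGraph p V)
    (y : ι × V → ZMod p) :
    graphState (G.copies ι) y = ∏ i, graphState G fun j => y (i, j) := by
  have hsqrt : Real.sqrt ((p : ℝ) ^ Fintype.card (ι × V))
      = Real.sqrt ((p : ℝ) ^ Fintype.card V) ^ Fintype.card ι := by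
    rw [Fintype.card_prod, mul_comm, pow_mul, sqrt_pow_of_nonneg (by positivity)]
  simp only [graphState_apply, LabeledGraph.phaseForm_copies, addChar_sum,
    Finset.prod_mul_distrib, Finset.prod_const, Finset.card_univ, inv_pow, hsqrt,
    Complex.ofReal_pow]

variable {k : ℕ}

theorem graphCodeEncoder_eq_linearCombination_comp (G : LabeledGraph p V)
    (C : Matrix (Fin k) V (ZMod p)) :
    graphCodeEncoder G C
      = Fintype.linearCombination ℂ (fun r => pauliZ (r ᵥ* C) (graphState G)) ∘ₗ
          hadamardAdjoint := by
  refine LinearMap.ext fun φ => ?_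
  simp only [graphCodeEncoder, LinearMap.sum_apply]
  rfl

theorem range_graphCodeEncoder (G : LabeledGraph p V) (C : Matrix (Fin k) V (ZMod p)) :
    LinearMap.range (graphCodeEncoder G C)
      = cwsCode G (LinearMap.range C.vecMulLinear : Set (V → ZMod p)) := by
  rw [graphCodeEncoder_eq_linearCombination_comp, LinearMap.range_comp_of_range_eq_top _
    (LinearMap.range_eq_top.mpr hadamardAdjoint_surjective), Fintype.range_linearCombination,
    cwsCode, LinearMap.coe_range, ← Set.range_comp]
  rfl

theorem graphCodeEncoder_apply (G : LabeledGraph p V) (C : Matrix (Fin k) V (ZMod p))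
    (φ : Ket p (Fin k)) (y : V → ZMod p) :
    graphCodeEncoder G C φ y
      = ((Real.sqrt ((p : ℝ) ^ k) : ℝ) : ℂ) * φ (C *ᵥ y) * graphState G y := by
  have hsum := sum_hadamardAdjoint_mul_stdAddChar φ (C *ᵥ y)
  rw [Fintype.card_fin] at hsum
  rw [graphCodeEncoder_eq_linearCombination_comp, ← hsum, LinearMap.comp_apply,
    Fintype.linearCombination_apply, Finset.sum_apply, Finset.sum_mul]
  simp only [Pi.smul_apply, smul_eq_mul, pauliZ_apply, dotProduct_mulVec, mul_assoc]

end Quantum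

section Concatenation

open Matrix

variable {p : ℕ} [Fact p.Prime] {n k n' : ℕ} {Gin : LabeledGraph p (Fin n)}
  {Cin : Matrix (Fin k) (Fin n) (ZMod p)} {Gout : LabeledGraph p (Fin n' × Fin k)}
  {Gc : LabeledGraph p (Fin n' × Fin n)}

theorem blockPower_graphCodeEncoder_apply (φ : Ket p (Fin n' × Fin k))
    (y : Fin n' × Fin n → ZMod p) :
    blockPower n' (graphCodeEncoder Gin Cin) φ y
      = ((Real.sqrt ((p : ℝ) ^ (n' * k)) : ℝ) : ℂ) *
        φ (blockGenerator (Fin n') Cin *ᵥ y) *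
        graphState (Gin.copies (Fin n')) y := by
  have hsqrt : Real.sqrt ((p : ℝ) ^ (n' * k)) = Real.sqrt ((p : ℝ) ^ k) ^ n' := by
    rw [mul_comm, pow_mul, sqrt_pow_of_nonneg (by positivity)]
  have hblock (i : Fin n') : Cin *ᵥ (fun j => y (i, j))
      = fun a => (blockGenerator (Fin n') Cin *ᵥ y) (i, a) :=
    funext fun _ => (blockGenerator_mulVec_apply ..).symm
  simp only [blockPower, LinearMap.coe_mk, AddHom.coe_mk, graphCodeEncoder_apply, hblock,
    Finset.prod_mul_distrib, Finset.prod_const, Finset.card_univ, Fintype.card_fin]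
  rw [Finset.sum_eq_single (blockGenerator (Fin n') Cin *ᵥ y)]
  · simp only [Pi.single_eq_same, Finset.prod_const_one, mul_one, graphState_copies, hsqrt,
      Complex.ofReal_pow]
    ring
  · intro x _ hx
    obtain ⟨⟨i, a⟩, hia⟩ := Function.ne_iff.mp hx
    rw [Finset.prod_eq_zero (Finset.mem_univ i)
      (Pi.single_eq_of_ne (fun h => hia (congrFun h a).symm) _)]
    ring
  · simp

theorem blockPower_pauliZ_graphState
    (h : ∀ y, Gc.phaseForm y
      = Gout.phaseForm (blockGenerator (Fin n') Cin *ᵥ y)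
        + (Gin.copies (Fin n')).phaseForm y)
    (c : Fin n' × Fin k → ZMod p) :
    blockPower n' (graphCodeEncoder Gin Cin) (pauliZ c (graphState Gout))
      = pauliZ (blockEncode Cin c) (graphState Gc) := by
  ext y
  have hsqrt := ofReal_sqrt_pow_ne_zero (p := p) (n' * k)
  rw [blockPower_graphCodeEncoder_apply]
  simp only [pauliZ_apply, graphState_apply, h, AddChar.map_add_eq_mul, blockEncode_eq_vecMul,
    dotProduct_mulVec, Fintype.card_prod, Fintype.card_fin]
  field_simp

theorem concatenatedCode_cwsCode
    (h : ∀ y, Gc.phaseForm y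
      = Gout.phaseForm (blockGenerator (Fin n') Cin *ᵥ y)
        + (Gin.copies (Fin n')).phaseForm y)
    (Cout : Set (Fin n' × Fin k → ZMod p)) :
    concatenatedCode Gin Cin (cwsCode Gout Cout) = cwsCode Gc (classicalConcat Cin Cout) := by
  rw [concatenatedCode, cwsCode, cwsCode, classicalConcat, Submodule.map_span, Set.image_image,
    Set.image_image]
  simp only [blockPower_pauliZ_graphState h]

end Concatenation

theorem mainTheorem1 (p : ℕ) [Fact p.Prime] (n k n' : ℕ)
    -- the inner graph code, with `k`-dimensional linear code `Din` and generator matrix `Cin`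
    (Gin : LabeledGraph p (Fin n)) (Din : Submodule (ZMod p) (Fin n → ZMod p))
    (Cin : Matrix (Fin k) (Fin n) (ZMod p)) (hCin : IsGeneratorMatrix Cin Din)
    -- the outer CWS code, of length `n'` over systems of `k` qupits
    (Gout : LabeledGraph p (Fin n' × Fin k)) (Cout : Set (Fin n' × Fin k → ZMod p)) :
    -- the encoder of the inner code maps onto the CWS code `(Gin, Din)`
    LinearMap.range (graphCodeEncoder Gin Cin) = cwsCode Gin (Din : Set (Fin n → ZMod p)) ∧
    -- if no two adjacent auxiliary vertices have a common neighbour among the output vertices,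
    -- then graph concatenation can be carried out in every order, always with the same result
    ((∀ (u v : Fin n' × Fin k) (w : Fin n' × Fin n),
        (encodingGraph Gin Cin Gout).adj (Sum.inl u) (Sum.inl v) ≠ 0 →
        (encodingGraph Gin Cin Gout).adj (Sum.inl u) (Sum.inr w) ≠ 0 →
        (encodingGraph Gin Cin Gout).adj (Sum.inl v) (Sum.inr w) = 0) →
      ∃ Gc : LabeledGraph p (Fin n' × Fin n),
        ∀ l : List (Fin n' × Fin k), l.Nodup → (∀ u, u ∈ l) →
          (encodingGraph Gin Cin Gout).GraphConcatenation Sum.inl Sum.inr Sum.inr l Gc) ∧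
    -- whenever graph concatenation can be carried out, in some order `l`, with result `Gc`:
    (∀ l : List (Fin n' × Fin k), l.Nodup → (∀ u, u ∈ l) →
      ∀ Gc : LabeledGraph p (Fin n' × Fin n),
        (encodingGraph Gin Cin Gout).GraphConcatenation Sum.inl Sum.inr Sum.inr l Gc →
        -- the concatenated code is the CWS code of `Gc` and the classical concatenated code
        concatenatedCode Gin Cin (cwsCode Gout Cout) = cwsCode Gc (classicalConcat Cin Cout) ∧
        -- any other order in which it can be carried out gives the same graph
        (∀ l' : List (Fin n' × Fin k), l'.Nodup → (∀ u, u ∈ l') →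
          ∀ Gc' : LabeledGraph p (Fin n' × Fin n),
            (encodingGraph Gin Cin Gout).GraphConcatenation Sum.inl Sum.inr Sum.inr l' Gc' →
            Gc' = Gc) ∧
        -- if the outer classical code is linear, with generator matrix `B`, then so is the
        -- classical concatenated code, and the same procedure on the encoding graph with input
        -- vertices gives the graph, with input vertices, of the concatenated graph code
        (∀ (m : ℕ) (Dout : Submodule (ZMod p) (Fin n' × Fin k → ZMod p))
          (B : Matrix (Fin m) (Fin n' × Fin k) (ZMod p)),
          (Dout : Set (Fin n' × Fin k → ZMod p)) = Cout → IsGeneratorMatrix B Dout →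
          (∃ Dc : Submodule (ZMod p) (Fin n' × Fin n → ZMod p),
            (Dc : Set (Fin n' × Fin n → ZMod p)) = classicalConcat Cin Cout ∧
            IsGeneratorMatrix (Matrix.of fun i => blockEncode Cin (B i)) Dc) ∧
          (encodingGraphWithInputs Gin Cin Gout B).GraphConcatenation
            (fun u => Sum.inr (Sum.inl u)) (fun w => Sum.inr (Sum.inr w))
            (Sum.map id Sum.inr) l
            (Gc.withInputs (Matrix.of fun i => blockEncode Cin (B i))))) := by
  refine ⟨hCin.range_vecMulLinear ▸ range_graphCodeEncoder Gin Cin,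
    fun hcommon => LabeledGraph.exists_forall_graphConcatenation_of_no_common_neighbour
      (fun _ _ => Sum.inl_ne_inr) hcommon Sum.inr, fun l hl hmem Gc hGc => ⟨?_, ?_, ?_⟩⟩
  · exact concatenatedCode_cwsCode (phaseForm_of_graphConcatenation hl hmem hGc) Cout
  · intro l' hl' hmem' Gc' hGc'
    have hperm : l'.Perm l := (List.perm_ext_iff_of_nodup hl' hl).mpr (by simp [hmem, hmem'])
    exact hGc'.eq_of_perm (fun _ _ => Sum.inl_ne_inr) hperm hGc
  · rintro m Dout B rfl hB
    exact ⟨exists_isGeneratorMatrix_classicalConcat hCin.1 hB,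
      graphConcatenation_encodingGraphWithInputs hl hmem hGc B⟩
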